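/- Let $n\ge 0$, $m\ge 1$ and let $\psi_1,\dots,\psi_m:\mathbb R^n\to\mathbb R^n$ be similitudes with ratios $r_1,\dots,r_m\in(0,1)$, i.e. $|\psi_j(x)-\psi_j(y)|=r_j|x-y|$ for all $x,y\in\mathbb R^n$. For every integer $k\ge 1$ let $\mathcal N_k\subseteq\{1,\dots,m\}$ be non-empty, and put $\mathcal L^k=\mathcal N_1\times\cdots\times\mathcal N_k$. For a non-empty compact set $F\subset\mathbb R^n$ put $$\psi^k(F)=\bigcup_{(j_1,\dots,j_k)\in\mathcal L^k}(\psi_{j_1}\circ\cdots\circ\psi_{j_k})(F).$$ Suppose that the open set condition holds: there is a non-empty bounded open set $V\subset\mathbb R^n$ such that $\psi_j(V)\subset V$ for all $j$ and $\psi_i(V)\cap\psi_j(V)=\emptyset$ for all $i\ne j$. Then there is a unique non-empty compact set $E\subset\mathbb R^n$ such that $\psi^k(F)\to E$ in the Hausdorff metric as $k\to\infty$ for every non-empty compact set $F\subset\mathbb R^n$; there is a unique real number $s\ge 0$ such that $$\liminf_{k\to\infty}\sum_{(j_1,\dots,j_k)\in\mathcal L^k}(r_{j_1}\cdots r_{j_k})^t=\begin{cases}\infty,&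 t<s,\\ 0,& t>s;\end{cases}$$ and the Hausdorff dimension of $E$ is equal to $s$. -/

import Mathlib

open Set Filter Topology

namespace StatSelfSimilar

/-- `f` is a similitude (contracting similarity) of `ℝⁿ` with ratio `ρ ∈ (0, 1)`. -/
def IsSimilitude {n : ℕ} (ρ : ℝ) (f : EuclideanSpace ℝ (Fin n) → EuclideanSpace ℝ (Fin n)) :
    Prop :=
  0 < ρ ∧ ρ < 1 ∧ ∀ x y, dist (f x) (f y) = ρ * dist x y

/-- The set `L^k = N_1 × ⋯ × N_k` of admissible words of length `k`. The digit sets are indexed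
from `0` here: `N i` is the set of digits allowed at step `i + 1`. -/
def words {m : ℕ} (N : ℕ → Finset (Fin m)) (k : ℕ) : Finset (Fin k → Fin m) :=
  Fintype.piFinset fun i : Fin k => N i

/-- The composition `ψ_{j_1} ∘ ⋯ ∘ ψ_{j_k}` for a word `w = (j_1, …, j_k)`. -/
def wordMap {m : ℕ} {X : Type*} (ψ : Fin m → X → X) : (k : ℕ) → (Fin k → Fin m) → X → X
  | 0, _ => id
  | k + 1, w => ψ (w 0) ∘ wordMap ψ k (fun i => w i.succ)

/-- The set `ψ^k(F)`, the union of `ψ_{j_1} ∘ ⋯ ∘ ψ_{j_k} (F)` over all words in `L^k`. -/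
def levelSet {m : ℕ} {X : Type*} (ψ : Fin m → X → X) (N : ℕ → Finset (Fin m)) (k : ℕ)
    (F : Set X) : Set X :=
  ⋃ w ∈ words N k, wordMap ψ k w '' F

/-- `E` is a non-empty compact set such that `ψ^k(F) → E` in the Hausdorff metric for every
non-empty compact set `F`. -/
structure IsLimitSet {n m : ℕ} (ψ : Fin m → EuclideanSpace ℝ (Fin n) → EuclideanSpace ℝ (Fin n))
    (N : ℕ → Finset (Fin m)) (E : Set (EuclideanSpace ℝ (Fin n))) : Prop where
  nonempty : E.Nonempty
  isCompact : IsCompact E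
  tendsto : ∀ F : Set (EuclideanSpace ℝ (Fin n)), F.Nonempty → IsCompact F →
    Tendsto (fun k => Metric.hausdorffEDist (levelSet ψ N k F) E) atTop (𝓝 0)

/-- The open set condition (with a non-empty bounded open set). -/
def OpenSetCondition {n m : ℕ}
    (ψ : Fin m → EuclideanSpace ℝ (Fin n) → EuclideanSpace ℝ (Fin n)) : Prop :=
  ∃ V : Set (EuclideanSpace ℝ (Fin n)), V.Nonempty ∧ IsOpen V ∧ Bornology.IsBounded V ∧
    (∀ j, ψ j '' V ⊆ V) ∧ ∀ i j, i ≠ j → Disjoint (ψ i '' V) (ψ j '' V)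

/-- The sum of `(r_{j_1} ⋯ r_{j_k})^t` over all words in `L^k`. -/
noncomputable def levelSum {m : ℕ} (r : Fin m → ℝ) (N : ℕ → Finset (Fin m)) (t : ℝ) (k : ℕ) : ℝ :=
  ∑ w ∈ words N k, (∏ i, r (w i)) ^ t

/-- `s ≥ 0` is the exponent at which the lower limit of the sums over `L^k` jumps from `∞`
to `0`; the lower limit is taken in `[0, ∞]`. -/
structure IsCriticalExponent {m : ℕ} (r : Fin m → ℝ) (N : ℕ → Finset (Fin m)) (s : ℝ) : Prop where
  nonneg : 0 ≤ s
  eq_top : ∀ t : ℝ, t < s → liminf (fun k => ENNReal.ofReal (levelSum r N t k)) atTop = ⊤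
  eq_zero : ∀ t : ℝ, s < t → liminf (fun k => ENNReal.ofReal (levelSum r N t k)) atTop = 0

end StatSelfSimilar

/-! A point of the limit set is coded by an infinite word with admissible digits: the images of a
large invariant ball under longer and longer prefixes are nested and shrink to it. The coding map is
continuous on a compact product space, and its range is the limit (`IsCoding.isLimitSet_range`).

Raising the exponent by `δ` multiplies the `k`-th sum by at most `q ^ (δ * k)`, with `q < 1`
bounding the ratios. So a liminf that is not infinite at `t` vanishes beyond `t`, which gives the
critical exponent.

For the upper bound on the dimension, the level-`k` images of the ball cover the limit, and their
diameters to the power `t` add up to a constant times the level sum; a liminf is enough for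
Hausdorff measure (`IsCoding.dimH_range_le`).

For the lower bound at `t < s`, a product measure gives each cylinder a mass of at most `Q` times
its ratio to the power `t`. Stop each word when its ratio first drops to `d`. By the open set
condition, distinct stopped cylinders contain disjoint balls of radius comparable to `d`, so by
volume a set of diameter `d` meets boundedly many of them (`IsCoding.measure_preimage_le`). The mass
distribution principle concludes. -/

namespace StatSelfSimilar

/-! ### The critical exponent -/

section Exponent

variable {m : ℕ} {r : Fin m → ℝ} {N : ℕ → Finset (Fin m)}

lemma levelSum_eq_prod (hr : ∀ j, 0 < r j) (t : ℝ) (k : ℕ) :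
    levelSum r N t k = ∏ i ∈ Finset.range k, ∑ j ∈ N i, r j ^ t := by
  rw [← Fin.prod_univ_eq_prod_range (fun i => ∑ j ∈ N i, r j ^ t), Finset.prod_univ_sum]
  refine Finset.sum_congr rfl fun w _ => ?_
  exact (Real.finsetProd_rpow _ _ (fun i _ => (hr _).le) _).symm

lemma levelSum_pos (hr : ∀ j, 0 < r j) (hN : ∀ k, (N k).Nonempty) (t : ℝ) (k : ℕ) :
    0 < levelSum r N t k := by
  rw [levelSum_eq_prod hr]
  exact Finset.prod_pos fun i _ => Finset.sum_pos (fun j _ => Real.rpow_pos_of_pos (hr j) t) (hN i)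

lemma levelSum_le_rpow_mul {q : ℝ} (hr : ∀ j, 0 < r j) (hq : ∀ j, r j ≤ q) {t t' : ℝ}
    (htt' : t ≤ t') (k : ℕ) :
    levelSum r N t' k ≤ (q ^ (t' - t)) ^ k * levelSum r N t k := by
  unfold levelSum
  rw [Finset.mul_sum]
  refine Finset.sum_le_sum fun w _ => ?_
  have hpos : 0 < ∏ i, r (w i) := Finset.prod_pos fun i _ => hr _
  have hle : (∏ i, r (w i)) ^ (t' - t) ≤ (q ^ (t' - t)) ^ k := by
    rw [← Real.finsetProd_rpow _ _ (fun i _ => (hr _).le)]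
    calc ∏ i, r (w i) ^ (t' - t) ≤ ∏ _i : Fin k, q ^ (t' - t) :=
          Finset.prod_le_prod (fun i _ => Real.rpow_nonneg (hr _).le _)
            fun i _ => Real.rpow_le_rpow (hr _).le (hq _) (sub_nonneg.2 htt')
      _ = _ := by simp
  calc (∏ i, r (w i)) ^ t' = (∏ i, r (w i)) ^ (t' - t) * (∏ i, r (w i)) ^ t := by
        rw [← Real.rpow_add hpos]; ring_nf
    _ ≤ _ := mul_le_mul_of_nonneg_right hle (Real.rpow_nonneg hpos.le _)

/-- The sums at `t` stay below some finite `C` for infinitely many `k`; along those `k` the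
geometric factor drives the sums at `t'` to zero. -/
lemma liminf_levelSum_eq_zero {q : ℝ} (hr : ∀ j, 0 < r j) (hq : ∀ j, r j ≤ q) (hq0 : 0 < q)
    (hq1 : q < 1) {t t' : ℝ} (htt' : t < t')
    (h : liminf (fun k => ENNReal.ofReal (levelSum r N t k)) atTop ≠ ⊤) :
    liminf (fun k => ENNReal.ofReal (levelSum r N t' k)) atTop = 0 := by
  obtain ⟨C, hC, hCt⟩ := exists_between h.lt_top
  have hfreq : ∃ᶠ k in atTop, ENNReal.ofReal (levelSum r N t k) < C :=
    frequently_lt_of_liminf_lt (by isBoundedDefault) hC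
  have hθ : q ^ (t' - t) < 1 := Real.rpow_lt_one hq0.le hq1 (sub_pos.2 htt')
  have hθ0 : 0 < q ^ (t' - t) := Real.rpow_pos_of_pos hq0 _
  have hlim : Tendsto (fun k : ℕ => ENNReal.ofReal ((q ^ (t' - t)) ^ k) * C) atTop (𝓝 0) := by
    have h1 := ENNReal.tendsto_ofReal (tendsto_pow_atTop_nhds_zero_of_lt_one hθ0.le hθ)
    simpa using ENNReal.Tendsto.mul_const h1 (Or.inr hCt.ne)
  refine le_antisymm (le_of_forall_gt_imp_ge_of_dense fun δ hδ => ?_) bot_le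
  refine liminf_le_of_frequently_le' ?_
  refine (hfreq.and_eventually (hlim.eventually_lt_const hδ)).mono fun k hk => ?_
  refine le_trans ?_ hk.2.le
  calc ENNReal.ofReal (levelSum r N t' k)
      ≤ ENNReal.ofReal ((q ^ (t' - t)) ^ k * levelSum r N t k) :=
        ENNReal.ofReal_le_ofReal (levelSum_le_rpow_mul hr hq htt'.le k)
    _ = ENNReal.ofReal ((q ^ (t' - t)) ^ k) * ENNReal.ofReal (levelSum r N t k) :=
        ENNReal.ofReal_mul (by positivity)
    _ ≤ _ := by gcongr; exact hk.1.le

lemma levelSum_zero_exponent (k : ℕ) : levelSum r N 0 k = (words N k).card := by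
  simp [levelSum]

lemma words_nonempty (hN : ∀ k, (N k).Nonempty) (k : ℕ) : (words N k).Nonempty :=
  Fintype.piFinset_nonempty.2 fun i => hN i

lemma card_words_le (k : ℕ) : (words N k).card ≤ m ^ k := by
  simpa using Finset.card_le_univ (words N k)

lemma exists_liminf_levelSum_ne_top {q : ℝ} (hr : ∀ j, 0 < r j) (hq : ∀ j, r j ≤ q)
    (hq0 : 0 < q) (hq1 : q < 1) :
    ∃ t, liminf (fun k => ENNReal.ofReal (levelSum r N t k)) atTop ≠ ⊤ := by
  -- At exponent `l` each word contributes at most `(q ^ l) ^ k`, which beats the at most `m ^ k`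
  -- words.
  obtain ⟨l, hl⟩ := exists_pow_lt_of_lt_one (show (0 : ℝ) < 1 / (m + 1) by positivity) hq1
  refine ⟨l, ne_top_of_le_ne_top ENNReal.one_ne_top (liminf_le_of_frequently_le'
    (Frequently.of_forall fun k => ENNReal.ofReal_le_one.2 ?_))⟩
  refine (levelSum_le_rpow_mul hr hq (Nat.cast_nonneg l) k).trans ?_
  rw [levelSum_zero_exponent, sub_zero, Real.rpow_natCast]
  have h1 : ((words N k).card : ℝ) ≤ (m : ℝ) ^ k := by exact_mod_cast card_words_le k
  have h2 : q ^ l * m ≤ 1 := by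
    have := mul_le_mul_of_nonneg_right hl.le (show (0 : ℝ) ≤ m + 1 by positivity)
    rw [one_div, inv_mul_cancel₀ (by positivity)] at this
    nlinarith [pow_pos hq0 l]
  calc (q ^ l) ^ k * ((words N k).card : ℝ) ≤ (q ^ l) ^ k * (m : ℝ) ^ k := by gcongr
    _ = (q ^ l * m) ^ k := (mul_pow _ _ _).symm
    _ ≤ 1 := pow_le_one₀ (by positivity) h2

lemma IsCriticalExponent.unique {s s' : ℝ} (h : IsCriticalExponent r N s)
    (h' : IsCriticalExponent r N s') : s = s' := by
  wlog hlt : s < s' generalizing s s'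
  · rcases lt_trichotomy s s' with h1 | h1 | h1
    · exact absurd h1 hlt
    · exact h1
    · exact (this h' h h1).symm
  obtain ⟨t, h1, h2⟩ := exists_between hlt
  have := (h.eq_zero t h1).symm.trans (h'.eq_top t h2)
  simp at this

theorem exists_isCriticalExponent {q : ℝ} (hr : ∀ j, 0 < r j) (hq : ∀ j, r j ≤ q)
    (hq0 : 0 < q) (hq1 : q < 1) (hN : ∀ k, (N k).Nonempty) :
    ∃ s, IsCriticalExponent r N s := by
  set L : ℝ → ENNReal := fun t => liminf (fun k => ENNReal.ofReal (levelSum r N t k)) atTop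
  have key : ∀ {t t'}, t < t' → L t ≠ ⊤ → L t' = 0 := fun htt' h =>
    liminf_levelSum_eq_zero hr hq hq0 hq1 htt' h
  -- At exponent `0` the sum counts words, so it is at least `1` and cannot have liminf zero.
  have hneg : ∀ t < 0, L t = ⊤ := by
    intro t ht
    by_contra h
    have h0 : (1 : ENNReal) ≤ L 0 := by
      refine le_liminf_of_le (by isBoundedDefault) (Eventually.of_forall fun k => ?_)
      rw [ENNReal.one_le_ofReal, levelSum_zero_exponent]
      exact_mod_cast Finset.card_pos.2 (words_nonempty hN k)
    rw [key ht h] at h0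
    simp at h0
  obtain ⟨T, hT⟩ := exists_liminf_levelSum_ne_top (N := N) hr hq hq0 hq1
  have hbdd : BddAbove {t | L t = ⊤} := ⟨T, fun t ht => not_lt.1 fun h => by
    have h0 := key h hT
    rw [mem_ofPred_eq, h0] at ht
    simp at ht⟩
  have hne : {t | L t = ⊤}.Nonempty := ⟨-1, hneg _ (by norm_num)⟩
  refine ⟨sSup {t | L t = ⊤}, le_of_forall_lt fun t ht => ?_, fun t ht => ?_, fun t ht => ?_⟩
  · exact (show t < t / 2 by linarith).trans_le (le_csSup hbdd (hneg _ (by linarith)))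
  · obtain ⟨t', ht', hlt⟩ := exists_lt_of_lt_csSup hne ht
    by_contra h
    have h0 := key hlt h
    rw [mem_ofPred_eq, h0] at ht'
    simp at ht'
  · obtain ⟨u, hu, hut⟩ := exists_between ht
    exact key hut fun h => (le_csSup hbdd h).not_gt hu

end Exponent

/-! ### Coding by infinite words and the limit set -/

section Coding

variable {n m : ℕ} {ψ : Fin m → EuclideanSpace ℝ (Fin n) → EuclideanSpace ℝ (Fin n)}
  {r : Fin m → ℝ} {N : ℕ → Finset (Fin m)}

/-- The definition peels off the outermost map; nested prefix images need the innermost one split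
off instead. -/
lemma wordMap_succ {X : Type*} (ψ : Fin m → X → X) (k : ℕ) (w : Fin (k + 1) → Fin m) :
    wordMap ψ (k + 1) w = wordMap ψ k (fun i => w i.castSucc) ∘ ψ (w (Fin.last k)) := by
  induction k with
  | zero => rfl
  | succ k ih =>
    rw [wordMap, ih, wordMap, Function.comp_assoc]
    rfl

/-- The composition `ψ_{ω 0} ∘ ⋯ ∘ ψ_{ω (k - 1)}` for an infinite word `ω`. -/
def prefixMap {X : Type*} (ψ : Fin m → X → X) (ω : ℕ → Fin m) (k : ℕ) : X → X :=
  wordMap ψ k fun i => ω i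

lemma prefixMap_zero {X : Type*} (ψ : Fin m → X → X) (ω : ℕ → Fin m) : prefixMap ψ ω 0 = id := rfl

lemma prefixMap_succ {X : Type*} (ψ : Fin m → X → X) (ω : ℕ → Fin m) (k : ℕ) :
    prefixMap ψ ω (k + 1) = prefixMap ψ ω k ∘ ψ (ω k) :=
  wordMap_succ ψ k _

lemma prefixMap_congr {X : Type*} (ψ : Fin m → X → X) {ω ω' : ℕ → Fin m} {k : ℕ}
    (h : ∀ i < k, ω i = ω' i) : prefixMap ψ ω k = prefixMap ψ ω' k := by
  unfold prefixMap
  congr 1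
  ext i
  rw [h i i.2]

lemma dist_prefixMap (hψ : ∀ j, IsSimilitude (r j) (ψ j)) (ω : ℕ → Fin m) (k : ℕ)
    (x y : EuclideanSpace ℝ (Fin n)) :
    dist (prefixMap ψ ω k x) (prefixMap ψ ω k y)
      = (∏ i ∈ Finset.range k, r (ω i)) * dist x y := by
  induction k generalizing x y with
  | zero => simp [prefixMap_zero]
  | succ k ih =>
    rw [prefixMap_succ, Function.comp_apply, Function.comp_apply, ih, (hψ _).2.2,
      Finset.prod_range_succ, mul_assoc]

lemma prefixMap_image_anti {X : Type*} {ψ : Fin m → X → X} {B : Set X}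
    (hB : ∀ j, ψ j '' B ⊆ B) (ω : ℕ → Fin m) : Antitone fun k => prefixMap ψ ω k '' B := by
  refine antitone_nat_of_succ_le fun k => ?_
  simp only [prefixMap_succ, image_comp]
  exact image_mono (hB _)

lemma IsSimilitude.continuous {ρ : ℝ}
    {f : EuclideanSpace ℝ (Fin n) → EuclideanSpace ℝ (Fin n)} (hf : IsSimilitude ρ f) :
    Continuous f :=
  (LipschitzWith.of_dist_le_mul (K := ρ.toNNReal) fun x y => by
    rw [hf.2.2, Real.coe_toNNReal _ hf.1.le]).continuous

lemma prefixMap_continuous (hψ : ∀ j, IsSimilitude (r j) (ψ j)) (ω : ℕ → Fin m) (k : ℕ) :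
    Continuous (prefixMap ψ ω k) := by
  induction k with
  | zero => exact continuous_id
  | succ k ih =>
    rw [prefixMap_succ]
    exact ih.comp (hψ _).continuous

lemma prod_prefix_pos (hr : ∀ j, 0 < r j) (ω : ℕ → Fin m) (k : ℕ) :
    0 < ∏ i ∈ Finset.range k, r (ω i) :=
  Finset.prod_pos fun _ _ => hr _

lemma prod_prefix_le {q : ℝ} (hr : ∀ j, 0 < r j) (hq : ∀ j, r j ≤ q) (ω : ℕ → Fin m) (k : ℕ) :
    ∏ i ∈ Finset.range k, r (ω i) ≤ q ^ k := by
  simpa using Finset.prod_le_prod (s := Finset.range k) (fun i _ => (hr (ω i)).le)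
    fun i _ => hq (ω i)

/-- Contractions have arbitrarily large common invariant closed balls. -/
lemma exists_closedBall_invariant (hψ : ∀ j, IsSimilitude (r j) (ψ j)) (R₀ : ℝ) :
    ∃ R, R₀ ≤ R ∧ 0 ≤ R ∧ ∀ j, ψ j '' Metric.closedBall 0 R ⊆ Metric.closedBall 0 R := by
  obtain ⟨C, hC⟩ := (Set.finite_range fun j => ‖ψ j 0‖ / (1 - r j)).bddAbove
  refine ⟨max (max R₀ 0) C, (le_max_left _ _).trans (le_max_left _ _),
    (le_max_right _ _).trans (le_max_left _ _), ?_⟩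
  rintro j _ ⟨x, hx, rfl⟩
  set R := max (max R₀ 0) C
  have h1 : ‖ψ j 0‖ ≤ R * (1 - r j) :=
    (div_le_iff₀ (sub_pos.2 (hψ j).2.1)).1 ((hC (mem_range_self j)).trans (le_max_right _ _))
  rw [mem_closedBall_zero_iff] at hx ⊢
  have h2 : dist (ψ j x) (ψ j 0) ≤ r j * R := by
    rw [(hψ j).2.2, dist_zero_right]
    exact mul_le_mul_of_nonneg_left hx (hψ j).1.le
  have h3 : ‖ψ j x‖ ≤ dist (ψ j x) (ψ j 0) + ‖ψ j 0‖ := by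
    simpa using dist_triangle (ψ j x) (ψ j 0) 0
  linarith

/-- The infinite words all of whose digits are admissible. -/
abbrev Code (N : ℕ → Finset (Fin m)) : Type := (i : ℕ) → N i

/-- The underlying sequence of digits. -/
def Code.digits (ω : Code N) (i : ℕ) : Fin m := (ω i).1

lemma Code.digits_mem_words (ω : Code N) (k : ℕ) : (fun i : Fin k => ω.digits i) ∈ words N k :=
  Fintype.mem_piFinset.2 fun i => (ω i).2

lemma exists_code_of_mem_words (hN : ∀ k, (N k).Nonempty) {k : ℕ} {w : Fin k → Fin m}
    (hw : w ∈ words N k) : ∃ ω : Code N, w = fun i : Fin k => ω.digits i := by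
  refine ⟨fun i => if h : i < k then ⟨w ⟨i, h⟩, Fintype.mem_piFinset.1 hw ⟨i, h⟩⟩
    else ⟨(hN i).choose, (hN i).choose_spec⟩, ?_⟩
  ext i
  simp [Code.digits]

/-- `p` maps each infinite word to the point it codes, relative to the invariant set `B`. -/
def IsCoding (ψ : Fin m → EuclideanSpace ℝ (Fin n) → EuclideanSpace ℝ (Fin n))
    (N : ℕ → Finset (Fin m)) (B : Set (EuclideanSpace ℝ (Fin n)))
    (p : Code N → EuclideanSpace ℝ (Fin n)) : Prop :=
  ∀ ω k, p ω ∈ prefixMap ψ ω.digits k '' B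

/-- Cantor's intersection theorem for the nested prefix images. -/
lemma exists_isCoding (hψ : ∀ j, IsSimilitude (r j) (ψ j)) {B : Set (EuclideanSpace ℝ (Fin n))}
    (hBc : IsCompact B) (hBn : B.Nonempty) (hB : ∀ j, ψ j '' B ⊆ B) :
    ∃ p, IsCoding ψ N B p := by
  have h : ∀ ω : Code N, ∃ x, ∀ k, x ∈ prefixMap ψ ω.digits k '' B := fun ω => by
    have hc : ∀ k, IsCompact (prefixMap ψ ω.digits k '' B) := fun k =>
      hBc.image (prefixMap_continuous hψ _ k)
    obtain ⟨x, hx⟩ := IsCompact.nonempty_iInter_of_sequence_nonempty_isCompact_isClosed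
      (fun k => prefixMap ψ ω.digits k '' B)
      (fun k => prefixMap_image_anti hB _ (Nat.le_succ k)) (fun k => hBn.image _) (hc 0)
      fun k => (hc k).isClosed
    exact ⟨x, mem_iInter.1 hx⟩
  choose p hp using h
  exact ⟨p, hp⟩

/-- The separate radius `D` lets the starting point lie outside the invariant ball, as convergence
from an arbitrary compact set requires. -/
lemma IsCoding.dist_le {R : ℝ} (hψ : ∀ j, IsSimilitude (r j) (ψ j))
    {p : Code N → EuclideanSpace ℝ (Fin n)} (hp : IsCoding ψ N (Metric.closedBall 0 R) p)
    (ω : Code N) (k : ℕ) {x : EuclideanSpace ℝ (Fin n)} {D : ℝ} (hx : x ∈ Metric.closedBall 0 D) :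
    dist (p ω) (prefixMap ψ ω.digits k x)
      ≤ (∏ i ∈ Finset.range k, r (ω.digits i)) * (R + D) := by
  obtain ⟨b, hb, hbp⟩ := hp ω k
  rw [← hbp, dist_prefixMap hψ]
  refine mul_le_mul_of_nonneg_left ?_ (prod_prefix_pos (fun j => (hψ j).1) _ k).le
  exact (dist_triangle_right b x 0).trans (add_le_add hb hx)

lemma IsCoding.continuous {R q : ℝ} (hψ : ∀ j, IsSimilitude (r j) (ψ j)) (hq : ∀ j, r j ≤ q)
    (hq0 : 0 < q) (hq1 : q < 1) (hR : 0 ≤ R)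
    {p : Code N → EuclideanSpace ℝ (Fin n)} (hp : IsCoding ψ N (Metric.closedBall 0 R) p) :
    Continuous p := by
  refine continuous_iff_continuousAt.2 fun ω => Metric.tendsto_nhds.2 fun ε hε => ?_
  have hlim : Tendsto (fun k : ℕ => q ^ k * (R + R)) atTop (𝓝 0) := by
    simpa using (tendsto_pow_atTop_nhds_zero_of_lt_one hq0.le hq1).mul_const (R + R)
  obtain ⟨k, hk⟩ := (hlim.eventually_lt_const hε).exists
  have hnear : ∀ᶠ ω' in 𝓝 ω, ∀ i ∈ Finset.range k, ω' i = ω i :=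
    (Finset.eventually_all _).2 fun i _ =>
      (continuous_apply i).continuousAt (isOpen_discrete {ω i} |>.mem_nhds rfl)
  refine hnear.mono fun ω' hω' => ?_
  obtain ⟨b, hb, hbp⟩ := hp ω' k
  have heq : prefixMap ψ ω'.digits k = prefixMap ψ ω.digits k :=
    prefixMap_congr ψ fun i hi => congrArg Subtype.val (hω' i (Finset.mem_range.2 hi))
  rw [← hbp, heq, dist_comm]
  refine ((hp.dist_le hψ ω k hb).trans ?_).trans_lt hk
  exact mul_le_mul_of_nonneg_right (prod_prefix_le (fun j => (hψ j).1) hq _ k) (by linarith)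

lemma mem_levelSet_iff (hN : ∀ k, (N k).Nonempty) {k : ℕ} {F : Set (EuclideanSpace ℝ (Fin n))}
    {z : EuclideanSpace ℝ (Fin n)} :
    z ∈ levelSet ψ N k F ↔ ∃ ω : Code N, ∃ x ∈ F, prefixMap ψ ω.digits k x = z := by
  simp only [levelSet, mem_iUnion, mem_image]
  constructor
  · rintro ⟨w, hw, x, hx, rfl⟩
    obtain ⟨ω, rfl⟩ := exists_code_of_mem_words hN hw
    exact ⟨ω, x, hx, rfl⟩
  · rintro ⟨ω, x, hx, rfl⟩
    exact ⟨_, ω.digits_mem_words k, x, hx, rfl⟩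

theorem IsCoding.isLimitSet_range {R q : ℝ} (hψ : ∀ j, IsSimilitude (r j) (ψ j))
    (hq : ∀ j, r j ≤ q) (hq0 : 0 < q) (hq1 : q < 1) (hR : 0 ≤ R) (hN : ∀ k, (N k).Nonempty)
    {p : Code N → EuclideanSpace ℝ (Fin n)} (hp : IsCoding ψ N (Metric.closedBall 0 R) p) :
    IsLimitSet ψ N (range p) where
  nonempty := by
    have : ∀ i, Nonempty (N i) := fun i => (hN i).to_subtype
    exact range_nonempty p
  isCompact := isCompact_range (hp.continuous hψ hq hq0 hq1 hR)
  tendsto := by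
    intro F hFn hFc
    obtain ⟨D, hD0, hD⟩ := hFc.isBounded.subset_closedBall_lt 0 0
    have hlim : Tendsto (fun k : ℕ => ENNReal.ofReal (q ^ k * (R + D))) atTop (𝓝 0) := by
      have := (tendsto_pow_atTop_nhds_zero_of_lt_one hq0.le hq1).mul_const (R + D)
      simpa using ENNReal.tendsto_ofReal this
    have hdist : ∀ (ω : Code N) (k : ℕ), ∀ x ∈ F,
        edist (p ω) (prefixMap ψ ω.digits k x) ≤ ENNReal.ofReal (q ^ k * (R + D)) := by
      intro ω k x hx
      rw [edist_dist]
      refine ENNReal.ofReal_le_ofReal ((hp.dist_le hψ ω k (hD hx)).trans ?_)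
      exact mul_le_mul_of_nonneg_right (prod_prefix_le (fun j => (hψ j).1) hq _ k) (by linarith)
    refine tendsto_of_tendsto_of_tendsto_of_le_of_le tendsto_const_nhds hlim
      (fun _ => bot_le) fun k => ?_
    refine Metric.hausdorffEDist_le_of_mem_edist (fun z hz => ?_) fun z hz => ?_
    · obtain ⟨ω, x, hx, rfl⟩ := (mem_levelSet_iff hN).1 hz
      exact ⟨p ω, mem_range_self ω, by rw [edist_comm]; exact hdist ω k x hx⟩
    · obtain ⟨ω, rfl⟩ := hz
      obtain ⟨x, hx⟩ := hFn
      exact ⟨_, (mem_levelSet_iff hN).2 ⟨ω, x, hx, rfl⟩, hdist ω k x hx⟩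

theorem IsLimitSet.unique {E E' : Set (EuclideanSpace ℝ (Fin n))} (h : IsLimitSet ψ N E)
    (h' : IsLimitSet ψ N E') : E = E' := by
  refine (h.isCompact.isClosed.hausdorffEDist_zero_iff h'.isCompact.isClosed).1 ?_
  have h1 := h.tendsto _ (singleton_nonempty 0) isCompact_singleton
  have h2 := h'.tendsto _ (singleton_nonempty 0) isCompact_singleton
  refine le_antisymm (ge_of_tendsto' (by simpa using h1.add h2) fun k => ?_) bot_le
  rw [Metric.hausdorffEDist_comm (t := E)]
  exact Metric.hausdorffEDist_triangle

end Coding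

/-! ### Stopped words and volume packing -/

section Packing

variable {n m : ℕ} {ψ : Fin m → EuclideanSpace ℝ (Fin n) → EuclideanSpace ℝ (Fin n)}
  {r : Fin m → ℝ} {N : ℕ → Finset (Fin m)}

/-- Rescaling by `ρ⁻¹` gives an isometry of a Euclidean space into itself, which is affine and hence
onto by dimension. Through this, prefix images of balls contain full balls of the scaled radius. -/
lemma IsSimilitude.surjective {ρ : ℝ}
    {f : EuclideanSpace ℝ (Fin n) → EuclideanSpace ℝ (Fin n)} (hf : IsSimilitude ρ f) :
    Function.Surjective f := by
  have hiso : Isometry fun x => ρ⁻¹ • f x := Isometry.of_dist_eq fun x y => by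
    rw [dist_smul₀, hf.2.2, Real.norm_of_nonneg (inv_nonneg.2 hf.1.le),
      inv_mul_cancel_left₀ hf.1.ne']
  intro y
  obtain ⟨x, hx⟩ := (hiso.affineIsometryOfStrictConvexSpace.toAffineIsometryEquiv rfl).surjective
    (ρ⁻¹ • y)
  exact ⟨x, smul_right_injective _ (inv_ne_zero hf.1.ne') hx⟩

lemma prefixMap_surjective (hψ : ∀ j, IsSimilitude (r j) (ψ j)) (ω : ℕ → Fin m) (k : ℕ) :
    Function.Surjective (prefixMap ψ ω k) := by
  induction k with
  | zero => exact Function.surjective_id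
  | succ k ih =>
    rw [prefixMap_succ]
    exact ih.comp (hψ _).surjective

lemma prefixMap_injective (hψ : ∀ j, IsSimilitude (r j) (ψ j)) (ω : ℕ → Fin m) (k : ℕ) :
    Function.Injective (prefixMap ψ ω k) := by
  intro x y hxy
  have h := dist_prefixMap hψ ω k x y
  rw [hxy, dist_self, eq_comm, mul_eq_zero] at h
  exact dist_eq_zero.1 (h.resolve_left (prod_prefix_pos (fun j => (hψ j).1) ω k).ne')

lemma ball_subset_prefixMap_image (hψ : ∀ j, IsSimilitude (r j) (ψ j)) (ω : ℕ → Fin m) (k : ℕ)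
    (x : EuclideanSpace ℝ (Fin n)) (ρ : ℝ) :
    Metric.ball (prefixMap ψ ω k x) ((∏ i ∈ Finset.range k, r (ω i)) * ρ)
      ⊆ prefixMap ψ ω k '' Metric.ball x ρ := by
  intro y hy
  obtain ⟨z, rfl⟩ := prefixMap_surjective hψ ω k y
  rw [Metric.mem_ball, dist_prefixMap hψ] at hy
  exact ⟨z, lt_of_mul_lt_mul_left hy (prod_prefix_pos (fun j => (hψ j).1) ω k).le, rfl⟩

lemma card_le_of_disjoint_balls {ι : Type*} (S : Finset ι) (c : ι → EuclideanSpace ℝ (Fin n))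
    {u : EuclideanSpace ℝ (Fin n)} {a b : ℝ} (ha : 0 < a) (hb : 0 ≤ b)
    (hdisj : (S : Set ι).PairwiseDisjoint fun i => Metric.ball (c i) a)
    (hsub : ∀ i ∈ S, Metric.ball (c i) a ⊆ Metric.closedBall u b) :
    (S.card : ℝ) ≤ (b / a) ^ n := by
  have h := MeasureTheory.measure_mono (μ := MeasureTheory.volume) (iUnion₂_subset hsub)
  rw [MeasureTheory.measure_biUnion_finset hdisj fun _ _ => measurableSet_ball,
    MeasureTheory.Measure.addHaar_closedBall _ _ hb] at h
  simp only [MeasureTheory.Measure.addHaar_ball_of_pos _ _ ha, Finset.sum_const, nsmul_eq_mul,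
    finrank_euclideanSpace_fin] at h
  rw [← mul_assoc, ENNReal.mul_le_mul_iff_left
    (Metric.measure_ball_pos _ _ one_pos).ne' MeasureTheory.measure_ball_lt_top.ne,
    ← ENNReal.ofReal_natCast, ← ENNReal.ofReal_mul (Nat.cast_nonneg _),
    ENNReal.ofReal_le_ofReal_iff (by positivity)] at h
  rwa [div_pow, le_div_iff₀ (by positivity)]

/-- The length of the first prefix whose ratio is at most `d`. -/
lemma exists_stopping {q a d : ℝ} (hr : ∀ j, 0 < r j) (hq : ∀ j, r j ≤ q)
    (hq1 : q < 1) (ha : ∀ j, a ≤ r j) (hd0 : 0 < d) (hd1 : d < 1) :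
    ∃ κ : (ℕ → Fin m) → ℕ, (∀ ω, ∏ i ∈ Finset.range (κ ω), r (ω i) ≤ d) ∧
      (∀ ω, d * a ≤ ∏ i ∈ Finset.range (κ ω), r (ω i)) ∧
      ∀ ω ω', (∀ i < κ ω, ω i = ω' i) → κ ω' = κ ω := by
  classical
  have hex : ∀ ω : ℕ → Fin m, ∃ k, ∏ i ∈ Finset.range k, r (ω i) ≤ d := fun ω => by
    obtain ⟨k, hk⟩ := exists_pow_lt_of_lt_one hd0 hq1
    exact ⟨k, (prod_prefix_le hr hq ω k).trans hk.le⟩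
  refine ⟨fun ω => Nat.find (hex ω), fun ω => Nat.find_spec (hex ω), fun ω => ?_,
    fun ω ω' h => ?_⟩
  · cases hk : Nat.find (hex ω) with
    -- The empty product is `1 > d`, so stopping at length zero is impossible.
    | zero =>
      have := Nat.find_spec (hex ω)
      rw [hk] at this
      simp only [Finset.range_zero, Finset.prod_empty] at this
      linarith
    | succ k =>
      have hmin : d < ∏ i ∈ Finset.range k, r (ω i) :=
        not_le.1 (Nat.find_min (hex ω) (hk ▸ Nat.lt_succ_self k))
      change d * a ≤ ∏ i ∈ Finset.range (Nat.find (hex ω)), r (ω i)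
      rw [hk, Finset.prod_range_succ]
      calc d * a ≤ d * r (ω k) := mul_le_mul_of_nonneg_left (ha _) hd0.le
        _ ≤ _ := mul_le_mul_of_nonneg_right hmin.le (hr _).le
  · have hprod : ∀ k ≤ Nat.find (hex ω),
        ∏ i ∈ Finset.range k, r (ω i) = ∏ i ∈ Finset.range k, r (ω' i) := fun k hk =>
      Finset.prod_congr rfl fun i hi => by rw [h i ((Finset.mem_range.1 hi).trans_le hk)]
    have h1 : Nat.find (hex ω') ≤ Nat.find (hex ω) :=
      Nat.find_min' _ (by rw [← hprod _ le_rfl]; exact Nat.find_spec (hex ω))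
    exact h1.antisymm (Nat.find_min' _ (by rw [hprod _ h1]; exact Nat.find_spec (hex ω')))

/-- If the sizes of pairwise unrelated finite subsets of `A` are bounded, then finitely many
elements of `A` are related to all of them. -/
lemma exists_finset_forall_rel {α : Type*} {A : Set α} {rel : α → α → Prop}
    (hrefl : ∀ x, rel x x) (hsymm : ∀ x y, rel x y → rel y x) {M : ℕ}
    (hM : ∀ S : Finset α, ↑S ⊆ A → (S : Set α).Pairwise (fun x y => ¬ rel x y) → S.card ≤ M) :
    ∃ S : Finset α, ↑S ⊆ A ∧ S.card ≤ M ∧ ∀ x ∈ A, ∃ y ∈ S, rel y x := by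
  classical
  by_contra! hcon
  have key : ∀ k, ∃ S : Finset α, ↑S ⊆ A ∧ (S : Set α).Pairwise (fun x y => ¬ rel x y) ∧
      S.card = k := by
    intro k
    induction k with
    | zero => exact ⟨∅, by simp, by simp, rfl⟩
    | succ k ih =>
      obtain ⟨S, hSA, hS, rfl⟩ := ih
      obtain ⟨x, hxA, hx⟩ := hcon S hSA (hM S hSA hS)
      have hxS : x ∉ S := fun h => hx x h (hrefl x)
      refine ⟨insert x S, ?_, ?_, Finset.card_insert_of_notMem hxS⟩
      · rw [Finset.coe_insert]
        exact insert_subset hxA hSA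
      · rw [Finset.coe_insert]
        exact hS.insert fun y hy _ => ⟨fun h => hx y hy (hsymm _ _ h), hx y hy⟩
  obtain ⟨S, hSA, hS, hcard⟩ := key (M + 1)
  have := hM S hSA hS
  omega

/-- Neither prefix extends the other, so the words first differ at an index below both lengths. Both
images then lie in disjoint first-level pieces, carried by one common injective prefix map. -/
lemma disjoint_prefixMap_image (hψ : ∀ j, IsSimilitude (r j) (ψ j))
    {V : Set (EuclideanSpace ℝ (Fin n))} (hV : ∀ j, ψ j '' V ⊆ V)
    (hdisj : ∀ i j, i ≠ j → Disjoint (ψ i '' V) (ψ j '' V)) {ω ω' : ℕ → Fin m} {k k' : ℕ}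
    (h : ¬ ∀ i < k, ω i = ω' i) (h' : ¬ ∀ i < k', ω' i = ω i) :
    Disjoint (prefixMap ψ ω k '' V) (prefixMap ψ ω' k' '' V) := by
  classical
  push Not at h h'
  have hex : ∃ i, ω i ≠ ω' i := h.imp fun _ hi => hi.2
  set i := Nat.find hex with hi
  have hik : i < k := by
    obtain ⟨j, hj, hne⟩ := h
    exact (Nat.find_min' hex hne).trans_lt hj
  have hik' : i < k' := by
    obtain ⟨j, hj, hne⟩ := h'
    exact (Nat.find_min' hex hne.symm).trans_lt hj
  refine Disjoint.mono (prefixMap_image_anti hV ω hik) (prefixMap_image_anti hV ω' hik') ?_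
  have heq : prefixMap ψ ω' i = prefixMap ψ ω i :=
    prefixMap_congr ψ fun l hl => (not_not.1 (Nat.find_min hex hl)).symm
  simp only [Nat.succ_eq_add_one, prefixMap_succ, image_comp, heq]
  exact (disjoint_image_iff (prefixMap_injective hψ ω i)).2 (hdisj _ _ (Nat.find_spec hex))

end Packing

/-! ### The two dimension bounds -/

section Dimension

open MeasureTheory

variable {n m : ℕ} {ψ : Fin m → EuclideanSpace ℝ (Fin n) → EuclideanSpace ℝ (Fin n)}
  {r : Fin m → ℝ} {N : ℕ → Finset (Fin m)}

/-- Digits are drawn independently, `j` at step `i` with probability proportional to `r j ^ t`; the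
normalising constants multiply to the level sum. -/
lemma exists_code_measure (hr : ∀ j, 0 < r j) (hN : ∀ k, (N k).Nonempty) (t : ℝ) :
    ∃ μ : Measure (Code N), IsProbabilityMeasure μ ∧ ∀ (ω : Code N) (k : ℕ),
      μ {ω' | ∀ i < k, ω.digits i = ω'.digits i}
        = ENNReal.ofReal ((∏ i ∈ Finset.range k, r (ω.digits i)) ^ t / levelSum r N t k) := by
  have hpos : ∀ j, 0 < r j ^ t := fun j => Real.rpow_pos_of_pos (hr j) t
  have hσ : ∀ i, 0 < ∑ j ∈ N i, r j ^ t := fun i => Finset.sum_pos (fun j _ => hpos j) (hN i)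
  have hsum : ∀ i, ∑ j : N i, ENNReal.ofReal (r j ^ t / ∑ j ∈ N i, r j ^ t) = 1 := fun i => by
    rw [← ENNReal.ofReal_sum_of_nonneg fun j _ => (div_pos (hpos _) (hσ i)).le,
      ← Finset.sum_div, Finset.sum_coe_sort (N i) fun j => r j ^ t, div_self (hσ i).ne',
      ENNReal.ofReal_one]
  set P : (i : ℕ) → PMF (N i) := fun i => PMF.ofFintype _ (hsum i) with hP
  refine ⟨Measure.infinitePi fun i => (P i).toMeasure, inferInstance, fun ω k => ?_⟩
  have hset : {ω' : Code N | ∀ i < k, ω.digits i = ω'.digits i}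
      = (Finset.range k : Set ℕ).pi fun i => {ω i} := by
    ext ω'
    simp only [mem_ofPred_eq, Set.mem_pi, Finset.coe_range, mem_Iio, mem_singleton_iff]
    exact ⟨fun h i hi => Subtype.ext (h i hi).symm,
      fun h i hi => (congrArg Subtype.val (h i hi)).symm⟩
  rw [hset, Measure.infinitePi_pi _ fun i _ => measurableSet_singleton _,
    levelSum_eq_prod hr, ← Real.finsetProd_rpow _ _ (fun i _ => (hr _).le), ← Finset.prod_div_distrib,
    ENNReal.ofReal_prod_of_nonneg fun i _ => (div_pos (hpos _) (hσ i)).le]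
  refine Finset.prod_congr rfl fun i _ => ?_
  rw [PMF.toMeasure_apply_singleton _ _ (measurableSet_singleton _)]
  rfl

lemma exists_inv_levelSum_le (hr : ∀ j, 0 < r j) (hN : ∀ k, (N k).Nonempty) {t : ℝ}
    (h : liminf (fun k => ENNReal.ofReal (levelSum r N t k)) atTop = ⊤) :
    ∃ Q, 0 < Q ∧ ∀ k, (levelSum r N t k)⁻¹ ≤ Q := by
  have hev : ∀ᶠ k in atTop, (1 : ENNReal) < ENNReal.ofReal (levelSum r N t k) :=
    eventually_lt_of_lt_liminf (by rw [h]; exact ENNReal.one_lt_top) (by isBoundedDefault)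
  have hbdd : IsBoundedUnder (· ≤ ·) atTop fun k => (levelSum r N t k)⁻¹ :=
    ⟨1, eventually_map.2 (hev.mono fun k hk => inv_le_one_of_one_le₀ (ENNReal.one_lt_ofReal.1 hk).le)⟩
  obtain ⟨Q, hQ⟩ := hbdd.bddAbove_range
  exact ⟨Q, (inv_pos.2 (levelSum_pos hr hN t 0)).trans_le (hQ (mem_range_self 0)),
    fun k => hQ (mem_range_self k)⟩

lemma IsCoding.measure_preimage_le {R q a ρ t Q d : ℝ} {V : Set (EuclideanSpace ℝ (Fin n))}
    {x₀ : EuclideanSpace ℝ (Fin n)} {p : Code N → EuclideanSpace ℝ (Fin n)}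
    (hp : IsCoding ψ N (Metric.closedBall 0 R) p) (hψ : ∀ j, IsSimilitude (r j) (ψ j))
    (hq : ∀ j, r j ≤ q) (hq1 : q < 1) (ha0 : 0 < a) (ha : ∀ j, a ≤ r j)
    (hR : 0 ≤ R) (hρ : 0 < ρ) (ht : 0 ≤ t) (hd0 : 0 < d) (hd1 : d < 1)
    (hball : Metric.ball x₀ ρ ⊆ V) (hVR : V ⊆ Metric.closedBall 0 R) (hV : ∀ j, ψ j '' V ⊆ V)
    (hdisj : ∀ i j, i ≠ j → Disjoint (ψ i '' V) (ψ j '' V))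
    (hQ0 : 0 < Q) (hQ : ∀ k, (levelSum r N t k)⁻¹ ≤ Q) {μ : Measure (Code N)}
    (hμ : ∀ (ω : Code N) (k : ℕ), μ {ω' | ∀ i < k, ω.digits i = ω'.digits i}
        = ENNReal.ofReal ((∏ i ∈ Finset.range k, r (ω.digits i)) ^ t / levelSum r N t k))
    {U : Set (EuclideanSpace ℝ (Fin n))} (hU : ∀ x ∈ U, ∀ y ∈ U, dist x y ≤ d) :
    μ (p ⁻¹' U) ≤ ENNReal.ofReal (((1 + 2 * R) / (a * ρ)) ^ n * Q * d ^ t) := by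
  have hr : ∀ j, 0 < r j := fun j => (hψ j).1
  rcases U.eq_empty_or_nonempty with rfl | ⟨u, hu⟩
  · simp
  obtain ⟨κ, hκd, hκa, hκ⟩ := exists_stopping hr hq hq1 ha hd0 hd1
  set rel : Code N → Code N → Prop := fun ω ω' => ∀ i < κ ω.digits, ω.digits i = ω'.digits i
    with hrel
  -- The stopping length depends only on the stopped prefix, so related words stop together.
  have hsymm : ∀ ω ω', rel ω ω' → rel ω' ω := fun ω ω' h i hi =>
    (h i (by rwa [hκ _ _ h] at hi)).symm
  have hcard : ∀ S : Finset (Code N), ↑S ⊆ p ⁻¹' U →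
      (S : Set (Code N)).Pairwise (fun x y => ¬ rel x y) →
      (S.card : ℝ) ≤ ((1 + 2 * R) / (a * ρ)) ^ n := by
    intro S hSU hS
    have hsub : ∀ ω : Code N, Metric.ball (prefixMap ψ ω.digits (κ ω.digits) x₀) (d * a * ρ)
        ⊆ prefixMap ψ ω.digits (κ ω.digits) '' V := fun ω =>
      (Metric.ball_subset_ball (mul_le_mul_of_nonneg_right (hκa _) hρ.le)).trans
        ((ball_subset_prefixMap_image hψ _ _ _ _).trans (image_mono hball))
    -- Radius `d * (1 + 2 * R)`: `d` from `u` to `p ω` inside `U`, and `2 * R * d` from `p ω` across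
    -- the stopped image.
    have := card_le_of_disjoint_balls S
      (fun ω => prefixMap ψ ω.digits (κ ω.digits) x₀) (u := u) (a := d * a * ρ)
      (b := d * (1 + 2 * R)) (by positivity) (by positivity)
      (fun ω hω ω' hω' hne => (disjoint_prefixMap_image hψ hV hdisj (hS hω hω' hne)
        (hS hω' hω hne.symm)).mono (hsub ω) (hsub ω'))
      fun ω hω => (hsub ω).trans ?_
    · rwa [mul_assoc, mul_div_mul_left _ _ hd0.ne'] at this
    · rintro _ ⟨v, hv, rfl⟩
      have h1 := hp.dist_le hψ ω (κ ω.digits) (hVR hv)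
      have h2 := hU _ (hSU hω) u hu
      have h3 : (∏ i ∈ Finset.range (κ ω.digits), r (ω.digits i)) * (R + R) ≤ d * (R + R) :=
        mul_le_mul_of_nonneg_right (hκd _) (by linarith)
      have h4 := dist_triangle_left (prefixMap ψ ω.digits (κ ω.digits) v) u (p ω)
      rw [Metric.mem_closedBall]
      linarith
  obtain ⟨S, hSU, hSM, hS⟩ := exists_finset_forall_rel (fun ω i _ => rfl) hsymm
    fun S hSU hS => Nat.le_floor (hcard S hSU hS)
  have hcyl : ∀ ω : Code N, μ {ω' | rel ω ω'} ≤ ENNReal.ofReal (Q * d ^ t) := fun ω => by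
    rw [hμ ω (κ ω.digits), div_eq_mul_inv, mul_comm]
    refine ENNReal.ofReal_le_ofReal (mul_le_mul (hQ _) ?_
      (Real.rpow_nonneg (prod_prefix_pos hr _ _).le _) hQ0.le)
    exact Real.rpow_le_rpow (prod_prefix_pos hr _ _).le (hκd _) ht
  calc μ (p ⁻¹' U) ≤ μ (⋃ ω ∈ S, {ω' | rel ω ω'}) := measure_mono fun x hx => by
        obtain ⟨y, hy, hyx⟩ := hS x hx
        exact mem_biUnion hy hyx
    _ ≤ ∑ ω ∈ S, μ {ω' | rel ω ω'} := measure_biUnion_finset_le _ _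
    _ ≤ ∑ _ω ∈ S, ENNReal.ofReal (Q * d ^ t) := Finset.sum_le_sum fun ω _ => hcyl ω
    _ = ENNReal.ofReal (S.card * (Q * d ^ t)) := by
        rw [Finset.sum_const, nsmul_eq_mul, ENNReal.ofReal_mul (Nat.cast_nonneg _),
          ENNReal.ofReal_natCast]
    _ ≤ _ := by
        refine ENNReal.ofReal_le_ofReal ?_
        rw [mul_assoc]
        refine mul_le_mul_of_nonneg_right ?_ (by positivity)
        exact (Nat.cast_le.2 hSM).trans (Nat.floor_le (by positivity))

/-- The mass distribution principle. -/
lemma le_dimH_of_measure_preimage_le {Ω : Type*} [MeasurableSpace Ω] {μ : Measure Ω}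
    [IsProbabilityMeasure μ] {p : Ω → EuclideanSpace ℝ (Fin n)} (hp : Measurable p) {t : NNReal}
    {K : ℝ} (hK : 0 < K)
    (h : ∀ d : ℝ, 0 < d → d < 1 → ∀ U : Set (EuclideanSpace ℝ (Fin n)),
      (∀ x ∈ U, ∀ y ∈ U, dist x y ≤ d) → μ (p ⁻¹' U) ≤ ENNReal.ofReal (K * d ^ (t : ℝ))) :
    (t : ENNReal) ≤ dimH (range p) := by
  have hK0 : ENNReal.ofReal K ≠ 0 := (ENNReal.ofReal_pos.2 hK).ne'
  have hle : (ENNReal.ofReal K)⁻¹ • μ.map p ≤ Measure.hausdorffMeasure (t : ℝ) := by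
    -- Diameters up to `1 / 2` leave room for some `d` strictly between the diameter and `1`.
    refine Measure.le_hausdorffMeasure _ _ (ENNReal.ofReal (1 / 2)) (by simp) fun U hU => ?_
    have hUtop : Metric.ediam U ≠ ⊤ := ne_top_of_le_ne_top ENNReal.ofReal_ne_top hU
    set e := (Metric.ediam U).toReal with he
    have heU : Metric.ediam U = ENNReal.ofReal e := (ENNReal.ofReal_toReal hUtop).symm
    have he0 : 0 ≤ e := ENNReal.toReal_nonneg
    have he1 : e < 1 := by
      have := ENNReal.toReal_mono ENNReal.ofReal_ne_top hU
      rw [ENNReal.toReal_ofReal (by norm_num)] at this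
      linarith
    have hclosure : ∀ x ∈ closure U, ∀ y ∈ closure U, dist x y ≤ e := fun x hx y hy => by
      have := Metric.edist_le_ediam_of_mem hx hy
      rwa [Metric.ediam_closure, heU, edist_dist, ENNReal.ofReal_le_ofReal_iff he0] at this
    -- The diameter `e` may be `0` while `h` needs `d > 0`, so let `d` decrease to `e`. The closure
    -- has the same diameter and is measurable.
    have hlim : μ (p ⁻¹' closure U) ≤ ENNReal.ofReal (K * e ^ (t : ℝ)) := by
      have hcont : Tendsto (fun d : ℝ => ENNReal.ofReal (K * d ^ (t : ℝ))) (𝓝[>] e)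
          (𝓝 (ENNReal.ofReal (K * e ^ (t : ℝ)))) :=
        (ENNReal.continuous_ofReal.comp
          (continuous_const.mul (Real.continuous_rpow_const t.coe_nonneg))).continuousAt.mono_left
            nhdsWithin_le_nhds
      refine ge_of_tendsto hcont ?_
      filter_upwards [Ioo_mem_nhdsGT he1] with d hd
      exact h d (he0.trans_lt hd.1) hd.2 _ fun x hx y hy => (hclosure x hx y hy).trans hd.1.le
    rw [Measure.smul_apply, smul_eq_mul, ENNReal.inv_mul_le_iff hK0 ENNReal.ofReal_ne_top, heU,
      ENNReal.ofReal_rpow_of_nonneg he0 t.coe_nonneg, ← ENNReal.ofReal_mul hK.le]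
    refine (measure_mono subset_closure).trans ?_
    rwa [Measure.map_apply hp isClosed_closure.measurableSet]
  refine le_dimH_of_hausdorffMeasure_ne_zero fun h0 => ?_
  have h1 := hle (range p)
  rw [h0, Measure.smul_apply, smul_eq_mul, nonpos_iff_eq_zero, mul_eq_zero] at h1
  rcases h1 with h1 | h1
  · simp at h1
  · have h2 : μ univ ≤ μ.map p (range p) := by
      have := Measure.le_map_apply hp.aemeasurable (μ := μ) (range p)
      rwa [preimage_range] at this
    rw [h1, measure_univ] at h2
    simp at h2

lemma IsCoding.le_dimH_range {R q a s : ℝ} {V : Set (EuclideanSpace ℝ (Fin n))}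
    {p : Code N → EuclideanSpace ℝ (Fin n)}
    (hp : IsCoding ψ N (Metric.closedBall 0 R) p) (hψ : ∀ j, IsSimilitude (r j) (ψ j))
    (hN : ∀ k, (N k).Nonempty)
    (hq : ∀ j, r j ≤ q) (hq0 : 0 < q) (hq1 : q < 1) (ha0 : 0 < a) (ha : ∀ j, a ≤ r j)
    (hR : 0 ≤ R) (hVn : V.Nonempty) (hVo : IsOpen V)
    (hVR : V ⊆ Metric.closedBall 0 R) (hV : ∀ j, ψ j '' V ⊆ V)
    (hdisj : ∀ i j, i ≠ j → Disjoint (ψ i '' V) (ψ j '' V))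
    (hs : IsCriticalExponent r N s) : ENNReal.ofReal s ≤ dimH (range p) := by
  obtain ⟨x₀, hx₀⟩ := hVn
  obtain ⟨ρ, hρ, hball⟩ := Metric.isOpen_iff.1 hVo x₀ hx₀
  refine le_of_forall_lt_imp_le_of_dense fun c hc => ?_
  lift c to NNReal using hc.ne_top
  have hr : ∀ j, 0 < r j := fun j => (hψ j).1
  have hcs : (c : ℝ) < s := by
    rw [← ENNReal.ofReal_coe_nnreal] at hc
    exact (ENNReal.ofReal_lt_ofReal_iff_of_nonneg c.coe_nonneg).1 hc
  obtain ⟨Q, hQ0, hQ⟩ := exists_inv_levelSum_le hr hN (hs.eq_top c hcs)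
  obtain ⟨μ, hμp, hμ⟩ := exists_code_measure hr hN (c : ℝ)
  exact le_dimH_of_measure_preimage_le (μ := μ)
    (hp.continuous hψ hq hq0 hq1 hR).measurable (by positivity) fun d hd0 hd1 U hU =>
      hp.measure_preimage_le hψ hq hq1 ha0 ha hR hρ c.coe_nonneg hd0 hd1 hball hVR hV hdisj hQ0 hQ
        hμ hU

lemma IsCoding.dimH_range_le {R q s : ℝ} {p : Code N → EuclideanSpace ℝ (Fin n)}
    (hp : IsCoding ψ N (Metric.closedBall 0 R) p) (hψ : ∀ j, IsSimilitude (r j) (ψ j))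
    (hN : ∀ k, (N k).Nonempty) (hq : ∀ j, r j ≤ q) (hq0 : 0 < q) (hq1 : q < 1)
    (hR : 0 ≤ R) (hs : IsCriticalExponent r N s) : dimH (range p) ≤ ENNReal.ofReal s := by
  refine ENNReal.le_of_forall_pos_le_add fun ε hε _ => ?_
  have hr : ∀ j, 0 < r j := fun j => (hψ j).1
  set t : NNReal := s.toNNReal + ε with ht
  have hts : s < t := by
    rw [ht, NNReal.coe_add, Real.coe_toNNReal _ hs.nonneg]
    exact lt_add_of_pos_right s hε
  have ediam_le : ∀ k, ∀ w ∈ words N k, Metric.ediam (wordMap ψ k w '' Metric.closedBall 0 R)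
      ≤ ENNReal.ofReal ((∏ i, r (w i)) * (R + R)) := by
    intro k w hw
    obtain ⟨ω, rfl⟩ := exists_code_of_mem_words hN hw
    refine Metric.ediam_le ?_
    rintro _ ⟨x, hx, rfl⟩ _ ⟨y, hy, rfl⟩
    rw [edist_dist]
    refine ENNReal.ofReal_le_ofReal ?_
    have h1 := dist_prefixMap hψ ω.digits k x y
    rw [prefixMap] at h1
    rw [h1, Fin.prod_univ_eq_prod_range (fun i => r (ω.digits i))]
    exact mul_le_mul_of_nonneg_left ((dist_triangle_right x y 0).trans (add_le_add hx hy))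
      (prod_prefix_pos hr _ _).le
  have hlim : Tendsto (fun k : ℕ => ENNReal.ofReal (q ^ k * (R + R))) atTop (𝓝 0) := by
    have := (tendsto_pow_atTop_nhds_zero_of_lt_one hq0.le hq1).mul_const (R + R)
    simpa using ENNReal.tendsto_ofReal this
  -- The covers are indexed by admissible words only; each coded point lies in the image for its own
  -- prefix.
  have hH := Measure.hausdorffMeasure_le_liminf_sum (t : ℝ) (range p) _ hlim
    (fun k (w : words N k) => wordMap ψ k w '' Metric.closedBall 0 R)
    (Eventually.of_forall fun k w => (ediam_le k w w.2).trans (ENNReal.ofReal_le_ofReal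
      (mul_le_mul_of_nonneg_right ?_ (by linarith))))
    (Eventually.of_forall fun k => ?_)
  rotate_left
  · simpa using Finset.prod_le_prod (s := Finset.univ) (fun i _ => (hr (w.1 i)).le)
      fun i _ => hq (w.1 i)
  · rintro _ ⟨ω, rfl⟩
    exact mem_iUnion.2 ⟨⟨_, ω.digits_mem_words k⟩, hp ω k⟩
  have hterm : ∀ k, ∑ w : words N k,
      Metric.ediam (wordMap ψ k w '' Metric.closedBall 0 R) ^ (t : ℝ)
        ≤ ENNReal.ofReal ((R + R) ^ (t : ℝ)) * ENNReal.ofReal (levelSum r N t k) := by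
    intro k
    rw [← ENNReal.ofReal_mul (by positivity), levelSum, Finset.mul_sum,
      ENNReal.ofReal_sum_of_nonneg fun w _ => mul_nonneg (by positivity)
        (Real.rpow_nonneg (Finset.prod_nonneg fun i _ => (hr _).le) _),
      ← Finset.sum_coe_sort (words N k)]
    refine Finset.sum_le_sum fun w _ => ?_
    have hw : 0 ≤ ∏ i, r (w.1 i) := Finset.prod_nonneg fun i _ => (hr _).le
    refine (ENNReal.rpow_le_rpow (ediam_le k w w.2) t.coe_nonneg).trans_eq ?_
    rw [ENNReal.ofReal_rpow_of_nonneg (by positivity) t.coe_nonneg,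
      Real.mul_rpow hw (by positivity), mul_comm]
  have hzero : Measure.hausdorffMeasure (t : ℝ) (range p) = 0 := by
    refine le_antisymm (hH.trans ((liminf_le_liminf (Eventually.of_forall hterm)).trans_eq ?_))
      bot_le
    rw [ENNReal.liminf_const_mul_of_ne_top ENNReal.ofReal_ne_top, hs.eq_zero t hts, mul_zero]
  have := dimH_le_of_hausdorffMeasure_ne_top (hzero.trans_ne ENNReal.zero_ne_top)
  rwa [ht, ENNReal.coe_add] at this

end Dimension

end StatSelfSimilar

theorem theorem2 {n m : ℕ}
    (ψ : Fin m → EuclideanSpace ℝ (Fin n) → EuclideanSpace ℝ (Fin n)) (r : Fin m → ℝ)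
    (hψ : ∀ j, StatSelfSimilar.IsSimilitude (r j) (ψ j))
    (N : ℕ → Finset (Fin m)) (hN : ∀ k, (N k).Nonempty)
    (hosc : StatSelfSimilar.OpenSetCondition ψ) :
    (∃! E : Set (EuclideanSpace ℝ (Fin n)), StatSelfSimilar.IsLimitSet ψ N E) ∧
    (∃! s : ℝ, StatSelfSimilar.IsCriticalExponent r N s) ∧
    ∀ (E : Set (EuclideanSpace ℝ (Fin n))) (s : ℝ),
      StatSelfSimilar.IsLimitSet ψ N E → StatSelfSimilar.IsCriticalExponent r N s →
        dimH E = ENNReal.ofReal s := by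
  obtain ⟨V, hVn, hVo, hVb, hV, hdisj⟩ := hosc
  have : Nonempty (Fin m) := ⟨(hN 0).choose⟩
  obtain ⟨jmax, hq⟩ := Finite.exists_max r
  obtain ⟨jmin, ha⟩ := Finite.exists_min r
  have hr : ∀ j, 0 < r j := fun j => (hψ j).1
  have hq1 := (hψ jmax).2.1
  obtain ⟨R₀, hR₀⟩ := hVb.subset_closedBall 0
  obtain ⟨R, hRR₀, hR, hB⟩ := StatSelfSimilar.exists_closedBall_invariant hψ R₀
  have hVR : V ⊆ Metric.closedBall 0 R := hR₀.trans (Metric.closedBall_subset_closedBall hRR₀)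
  obtain ⟨p, hp⟩ := StatSelfSimilar.exists_isCoding (N := N) hψ (isCompact_closedBall 0 R)
    (Metric.nonempty_closedBall.2 hR) hB
  have hE := hp.isLimitSet_range hψ hq (hr _) hq1 hR hN
  refine ⟨⟨_, hE, fun E' hE' => hE'.unique hE⟩, ?_, fun E s hE' hs => ?_⟩
  · obtain ⟨s, hs⟩ := StatSelfSimilar.exists_isCriticalExponent hr hq (hr _) hq1 hN
    exact ⟨s, hs, fun s' hs' => hs'.unique hs⟩
  · rw [hE'.unique hE]
    exact le_antisymm (hp.dimH_range_le hψ hN hq (hr _) hq1 hR hs)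
      (hp.le_dimH_range hψ hN hq (hr _) hq1 (hr _) ha hR hVn hVo hVR hV hdisj hs)
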